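/- Let $F$ be a free group (of arbitrary, possibly infinite, rank), let $H$ and $K$ be finitely generated subgroups of $F$, and let $g \in F$. Then the double coset $HgK = \{hgk : h \in H,\ k \in K\}$ is closed in the profinite topology of $F$, i.e. in the topology generated by all cosets of subgroups of finite index of $F$. Equivalently, for every $f \in F$ with $f \notin HgK$ there is a subgroup $M$ of finite index in $F$ such that $Mf \cap HgK = \emptyset$. -/

import Mathlib

open scoped Pointwise Topology

/-- The profinite topology of a group `G`: the topology generated by all cosets of the
subgroups of finite index of `G`. (All left cosets are used; the right coset `M g` is the
left coset `g (g⁻¹ M g)` of a conjugate, so right cosets give the same topology.) -/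
@[reducible]
def profiniteTopology (G : Type*) [Group G] : TopologicalSpace G :=
  TopologicalSpace.generateFrom
    {U : Set G | ∃ (M : Subgroup G) (x : G), M.FiniteIndex ∧ U = x • (M : Set G)}

/-! Let S ⊆ F/H and T ⊆ F/K be finite sets containing the traces of the generators of H and K, and
of f and g; extend the partial action of the free generators to permutations of S and T. Let c be
the indicator of the orbit of (H, gK) in F/H × F/K. Twist the double cover of S × T so that the bit
is constant along genuine edges of S, while over genuine edges of T the sum of bit and c is
constant. If f and hgk act alike, start at (H, gK, true): following h keeps the bit true, following
f k⁻¹ g⁻¹ keeps the bit equal to c. Hence c(H, fK) is true, i.e. f ∈ HgK. -/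

/-- Tracing an element `w` of a free group through a set with an action involves only finitely
many points: a relation to a second such set that is respected by every edge between these
points is respected by `w`. -/
theorem FreeGroup.exists_finset_trace {α X : Type*} [MulAction (FreeGroup α) X]
    (w : FreeGroup α) (x : X) :
    ∃ A : Finset X, ∀ {Z : Type*} (ρ : FreeGroup α →* Equiv.Perm Z) (R : X → Z → Prop),
      (∀ a, ∀ y ∈ A, FreeGroup.of a • y ∈ A →
        ∀ z, R y z ↔ R (FreeGroup.of a • y) (ρ (FreeGroup.of a) z)) →
      ∀ z, R x z ↔ R (w • x) (ρ w z) := by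
  classical
  induction w using FreeGroup.induction_on generalizing x with
  | C1 => exact ⟨∅, fun ρ R _ z => by simp⟩
  | of a =>
    exact ⟨{x, FreeGroup.of a • x}, fun ρ R h z => h a x (by simp) (by simp) z⟩
  | inv_of a _ =>
    refine ⟨{x, (FreeGroup.of a)⁻¹ • x}, fun ρ R h z => ?_⟩
    have := h a ((FreeGroup.of a)⁻¹ • x) (by simp) (by simp) (ρ (FreeGroup.of a)⁻¹ z)
    simpa using this.symm
  | mul v w hv hw =>
    obtain ⟨A, hA⟩ := hw x
    obtain ⟨B, hB⟩ := hv (w • x)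
    refine ⟨A ∪ B, fun ρ R h z => ?_⟩
    rw [hA ρ R (fun a y hy hy' => h a y (Finset.mem_union_left _ hy)
        (Finset.mem_union_left _ hy')) z,
      hB ρ R (fun a y hy hy' => h a y (Finset.mem_union_right _ hy)
        (Finset.mem_union_right _ hy')) (ρ w z), mul_smul, _root_.map_mul, Equiv.Perm.mul_apply]

/-- The partial action of a group element on a finite subset of a set extends to a permutation
of that subset. -/
theorem Finset.exists_perm_extending_smul {G X : Type*} [Group G] [MulAction G X]
    (S : Finset X) (g : G) :
    ∃ π : Equiv.Perm S, ∀ y : S, g • (y : X) ∈ S → (π y : X) = g • (y : X) := by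
  classical
  obtain ⟨π, hπ⟩ := Set.MapsTo.exists_equiv_extend_of_card_eq (α := S) (t := S)
    (s := {y : S | g • (y : X) ∈ S}) (f := fun y => g • (y : X)) (by simp)
    (fun y hy => hy) (fun y _ z _ h => Subtype.ext (smul_left_cancel g h))
  exact ⟨π, hπ⟩

/-- A pair of permutations together with a `Bool`-valued cochain acts on the corresponding
double cover of the product. -/
def Equiv.Perm.twistedProd {Y X : Type*} (π : Equiv.Perm Y) (σ : Equiv.Perm X)
    (δ : Y → X → Bool) : Equiv.Perm (Y × X × Bool) where
  toFun z := (π z.1, σ z.2.1, xor z.2.2 (δ z.1 z.2.1))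
  invFun z := (π.symm z.1, σ.symm z.2.1, xor z.2.2 (δ (π.symm z.1) (σ.symm z.2.1)))
  left_inv z := by simp
  right_inv z := by simp

/-- In a free group, a double coset of finitely generated subgroups can be separated from every
element outside it by a normal subgroup of finite index. -/
theorem FreeGroup.exists_normal_separating_doubleCoset {α : Type*} {H K : Subgroup (FreeGroup α)}
    (hH : H.FG) (hK : K.FG) {f g : FreeGroup α} (hf : f ∉ DoubleCoset.doubleCoset g (H : Set _) K) :
    ∃ N : Subgroup (FreeGroup α), N.Normal ∧ N.FiniteIndex ∧
      ∀ n ∈ N, n * f ∉ DoubleCoset.doubleCoset g (H : Set _) K := by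
  classical
  obtain ⟨s, rfl⟩ := hH
  obtain ⟨t, rfl⟩ := hK
  set H := Subgroup.closure (s : Set (FreeGroup α))
  set K := Subgroup.closure (t : Set (FreeGroup α))
  let y₀ : FreeGroup α ⧸ H := (1 : FreeGroup α)
  let x₀ : FreeGroup α ⧸ K := (1 : FreeGroup α)
  have smul_y₀ {u : FreeGroup α} : u • y₀ = y₀ ↔ u ∈ H := by
    rw [← MulAction.mem_stabilizer_iff, MulAction.stabilizer_quotient]
  have smul_x₀ {u : FreeGroup α} : u • x₀ = x₀ ↔ u ∈ K := by
    rw [← MulAction.mem_stabilizer_iff, MulAction.stabilizer_quotient]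
  choose A hA using fun w => FreeGroup.exists_finset_trace (α := α) w y₀
  choose B hB using fun w => FreeGroup.exists_finset_trace (α := α) w x₀
  -- The traces do not depend on the action `ρ`, so these sets can be fixed before `ρ` is built.
  let S := insert y₀ (s.biUnion A)
  let T := insert (g • x₀) (t.biUnion B ∪ B f ∪ B g)
  choose π hπ using fun a : α => S.exists_perm_extending_smul (FreeGroup.of a)
  choose σ hσ using fun a : α => T.exists_perm_extending_smul (FreeGroup.of a)
  -- the orbit of the pair of base points
  let c (y : FreeGroup α ⧸ H) (x : FreeGroup α ⧸ K) : Bool :=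
    decide (∃ u : FreeGroup α, u • y₀ = y ∧ u • g • x₀ = x)
  have c_smul (v : FreeGroup α) (y x) : c (v • y) (v • x) = c y x := by
    refine decide_eq_decide.2 ⟨?_, ?_⟩
    · rintro ⟨u, hy, hx⟩
      exact ⟨v⁻¹ * u, by rw [mul_smul, hy, inv_smul_smul],
        by rw [mul_smul, hx, inv_smul_smul]⟩
    · rintro ⟨u, rfl, rfl⟩
      exact ⟨v * u, mul_smul .., mul_smul ..⟩
  -- No twist on genuine edges of S; elsewhere the coboundary of `c`.
  let δ (a : α) (y : S) (x : T) : Bool :=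
    if FreeGroup.of a • (y : FreeGroup α ⧸ H) ∈ S then false else xor (c y x) (c (π a y) (σ a x))
  let ρ : FreeGroup α →* Equiv.Perm (S × T × Bool) :=
    FreeGroup.lift fun a => (π a).twistedProd (σ a) (δ a)
  have ρ_of (a : α) (z) : ρ (FreeGroup.of a) z =
      (π a z.1, σ a z.2.1, xor z.2.2 (δ a z.1 z.2.1)) := by
    simp [ρ, Equiv.Perm.twistedProd]
  let RH (y : FreeGroup α ⧸ H) (z : S × T × Bool) : Prop := (z.1 : FreeGroup α ⧸ H) = y ∧ z.2.2 = true
  let RK (x : FreeGroup α ⧸ K) (z : S × T × Bool) : Prop :=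
    (z.2.1 : FreeGroup α ⧸ K) = x ∧ z.2.2 = c z.1 x
  have RH_of (a : α) (y) (hy : y ∈ S) (hy' : FreeGroup.of a • y ∈ S) (z) :
      RH y z ↔ RH (FreeGroup.of a • y) (ρ (FreeGroup.of a) z) := by
    obtain ⟨p, q, ε⟩ := z
    have key : ((p : FreeGroup α ⧸ H) = y) ↔ (π a p : FreeGroup α ⧸ H) = FreeGroup.of a • y := by
      rw [← hπ a ⟨y, hy⟩ hy', Subtype.coe_inj, (π a).apply_eq_iff_eq, Subtype.ext_iff]
    simp only [RH, ρ_of, ← key]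
    refine and_congr_right ?_
    rintro rfl
    simp [δ, hy']
  have RK_of (a : α) (x) (hx : x ∈ T) (hx' : FreeGroup.of a • x ∈ T) (z) :
      RK x z ↔ RK (FreeGroup.of a • x) (ρ (FreeGroup.of a) z) := by
    obtain ⟨p, q, ε⟩ := z
    have key : ((q : FreeGroup α ⧸ K) = x) ↔ (σ a q : FreeGroup α ⧸ K) = FreeGroup.of a • x := by
      rw [← hσ a ⟨x, hx⟩ hx', Subtype.coe_inj, (σ a).apply_eq_iff_eq, Subtype.ext_iff]
    simp only [RK, ρ_of, ← key]
    refine and_congr_right ?_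
    rintro rfl
    by_cases hp : FreeGroup.of a • (p : FreeGroup α ⧸ H) ∈ S
    -- Both edges are genuine, so `c` is invariant and the bit is unchanged.
    · simp [δ, hp, hπ a p hp, c_smul]
    -- The twist changes the bit by exactly the change of `c`.
    · simp only [δ, hp, if_false, hσ a q hx']
      cases ε <;> cases c p q <;> cases c (π a p) (FreeGroup.of a • (q : FreeGroup α ⧸ K)) <;> decide
  have RK_trace (w) (hw : B w ⊆ T) (z) : RK x₀ z ↔ RK (w • x₀) (ρ w z) :=
    hB w ρ RK (fun a y hy hy' => RK_of a y (hw hy) (hw hy')) z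
  have RH_H {h} (hh : h ∈ H) : ∀ z, RH y₀ z ↔ RH y₀ (ρ h z) := by
    induction hh using Subgroup.closure_induction with
    | mem h hh =>
      intro z
      have hS : A h ⊆ S := (Finset.subset_biUnion_of_mem A hh).trans (Finset.subset_insert _ _)
      have := hA h ρ RH (fun a y hy hy' => RH_of a y (hS hy) (hS hy')) z
      rwa [smul_y₀.2 (Subgroup.subset_closure hh)] at this
    | one => simp
    | mul u v _ _ hu hv => intro z; rw [hv, hu, _root_.map_mul, Equiv.Perm.mul_apply]
    | inv u _ hu => intro z; rw [hu (ρ u⁻¹ z)]; simp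
  have RK_K {k} (hk : k ∈ K) : ∀ z, RK x₀ z ↔ RK x₀ (ρ k z) := by
    induction hk using Subgroup.closure_induction with
    | mem k hk =>
      intro z
      have hT : B k ⊆ T := by
        refine (Finset.subset_biUnion_of_mem B hk).trans fun x hx => ?_
        simp only [T, Finset.mem_insert, Finset.mem_union, hx, true_or, or_true]
      have := RK_trace k hT z
      rwa [smul_x₀.2 (Subgroup.subset_closure hk)] at this
    | one => simp
    | mul u v _ _ hu hv => intro z; rw [hv, hu, _root_.map_mul, Equiv.Perm.mul_apply]
    | inv u _ hu => intro z; rw [hu (ρ u⁻¹ z)]; simp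
  have hBf : B f ⊆ T := fun x hx => by simp [T, hx]
  have hBg : B g ⊆ T := fun x hx => by simp [T, hx]
  refine ⟨ρ.ker, inferInstance, Subgroup.finiteIndex_ker ρ, fun n hn hnf => hf ?_⟩
  obtain ⟨h, hh, k, hk, hnf⟩ := DoubleCoset.mem_doubleCoset.1 hnf
  let z₀ : S × T × Bool := (⟨y₀, by simp [S]⟩, ⟨g • x₀, by simp [T]⟩, true)
  have hz₀ : RK (g • x₀) z₀ := ⟨rfl, (decide_eq_true ⟨1, one_smul _ _, one_smul _ _⟩).symm⟩
  have hz₁ : RK x₀ (ρ (k⁻¹ * g⁻¹) z₀) := by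
    rw [_root_.map_mul, Equiv.Perm.mul_apply, ← RK_K (inv_mem hk), RK_trace g hBg]
    simpa using hz₀
  have hz₂ := (RK_trace f hBf _).1 hz₁
  have hz₃ : ρ f (ρ (k⁻¹ * g⁻¹) z₀) = ρ h z₀ := by
    rw [← Equiv.Perm.mul_apply, ← _root_.map_mul]
    have : h = n * (f * (k⁻¹ * g⁻¹)) := by rw [← mul_assoc, hnf]; group
    rw [this, _root_.map_mul _ n, MonoidHom.mem_ker.1 hn, one_mul]
  -- The same point now has bit `c y₀ (f • x₀)` by `RK` and bit `true` by `RH`.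
  rw [hz₃] at hz₂
  obtain ⟨hy, hε⟩ := (RH_H hh z₀).1 ⟨rfl, rfl⟩
  have hc := hz₂.2
  rw [hε, hy] at hc
  obtain ⟨u, hu, hu'⟩ := of_decide_eq_true hc.symm
  refine DoubleCoset.mem_doubleCoset.2 ⟨u, smul_y₀.1 hu, (u * g)⁻¹ * f, smul_x₀.1 ?_, by group⟩
  rw [mul_smul, ← hu', ← mul_smul u, inv_smul_smul]

theorem IsFreeGroup.exists_normal_separating_doubleCoset {F : Type*} [Group F] [IsFreeGroup F]
    {H K : Subgroup F} (hH : H.FG) (hK : K.FG) {f g : F}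
    (hf : f ∉ DoubleCoset.doubleCoset g (H : Set F) K) :
    ∃ N : Subgroup F, N.Normal ∧ N.FiniteIndex ∧
      ∀ n ∈ N, n * f ∉ DoubleCoset.doubleCoset g (H : Set F) K := by
  let e := IsFreeGroup.toFreeGroup F
  have mem_iff (u : F) : e u ∈ DoubleCoset.doubleCoset (e g)
      (H.map e.toMonoidHom : Set (FreeGroup (IsFreeGroup.Generators F))) (K.map e.toMonoidHom) ↔
        u ∈ DoubleCoset.doubleCoset g (H : Set F) K := by
    simp [DoubleCoset.mem_doubleCoset, ← _root_.map_mul]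
  have fg_map {L : Subgroup F} (hL : L.FG) : (L.map e.toMonoidHom).FG := by
    rw [Subgroup.fg_iff_submonoid_fg] at hL ⊢
    exact hL.map e.toMonoidHom
  obtain ⟨N, hN, hN', h⟩ := FreeGroup.exists_normal_separating_doubleCoset
    (fg_map hH) (fg_map hK) (mt (mem_iff f).1 hf)
  refine ⟨N.comap e.toMonoidHom, inferInstance, ⟨?_⟩, fun n hn hnf => ?_⟩
  · rw [Subgroup.index_comap_of_surjective N (f := e.toMonoidHom) e.surjective]
    exact hN'.index_ne_zero
  exact h (e n) hn (by rw [← _root_.map_mul]; exact (mem_iff _).2 hnf)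

theorem mainTheorem1 {F : Type*} [Group F] [IsFreeGroup F] (H K : Subgroup F)
    (hH : H.FG) (hK : K.FG) (g : F) :
    IsClosed[profiniteTopology F] (DoubleCoset.doubleCoset g (H : Set F) (K : Set F)) ∧
      ∀ f : F, f ∉ DoubleCoset.doubleCoset g (H : Set F) (K : Set F) →
        ∃ M : Subgroup F, M.FiniteIndex ∧
          (MulOpposite.op f • (M : Set F)) ∩
            DoubleCoset.doubleCoset g (H : Set F) (K : Set F) = ∅ := by
  constructor
  · let := profiniteTopology F
    rw [← isOpen_compl_iff, isOpen_iff_forall_mem_open]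
    intro f hf
    obtain ⟨N, hN, hN', h⟩ := IsFreeGroup.exists_normal_separating_doubleCoset hH hK hf
    refine ⟨f • (N : Set F), ?_, TopologicalSpace.isOpen_generateFrom_of_mem ⟨N, f, hN', rfl⟩,
      ⟨1, N.one_mem, mul_one f⟩⟩
    rintro _ ⟨n, hn, rfl⟩
    -- By normality the left coset of f is also its right coset.
    simpa using h (f * n * f⁻¹) (hN.conj_mem n hn f)
  · intro f hf
    obtain ⟨N, -, hN, h⟩ := IsFreeGroup.exists_normal_separating_doubleCoset hH hK hf
    refine ⟨N, hN, Set.eq_empty_of_forall_notMem ?_⟩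
    rintro _ ⟨⟨n, hn, rfl⟩, hnf⟩
    exact h n hn hnf
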